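/- Let $m\ge 1$, let $0<\alpha_1<\dots<\alpha_m<1$, and let $\epsilon\in(0,1/2)$. Let the vector of p-values $p=(p_1,\dots,p_m)$ be random in $[0,1]^m$ with a Lebesgue density $f_p$ such that for every $\delta>0$ there is $\kappa>0$ with $f_p>\kappa$ on $[\delta,1-\delta]^m$. With $p_{(1)}\le\dots\le p_{(m)}$ the ordered p-values, the step-up procedure rejects the hypotheses with the $k$ smallest p-values, where $k$ is the largest index with $p_{(k)}\le\alpha_k$ (and rejects none if there is no such $k$). The step-down procedure rejects the hypotheses with the $k-1$ smallest p-values, where $k$ is the smallest index with $p_{(k)}>\alpha_k$ (and rejects all if there is no such $k$). A Monte Carlo algorithm does not observe $p$. It successively draws simulations, at each step choosing, from the outcomes seen so far and possibly from independent internal randomness, the hypothesis $H_{0i}$ for which the next simulation is drawn. Given $p$, a simulation for $H_{0i}$ is a Bernoulli($p_i$) variable, and all simulations are independent of each other and of the internal randomness. After each number of simulations the algorithm may announce decisions (rejected or not rejected) on some of the hypotheses. It guarantees correctness at level $1-\epsilon$ for a procedure if, for every fixed $p\in[0,1]^m$, with probability at least $1-\epsilon$ all the decisions it ever announces agree with those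 of the procedure applied to $p$. For $1\le k\le m$ let $\tau_k\in\{0,1,2,\dots\}\cup\{\infty\}$ be the number of simulations drawn until decisions on at least $k$ hypotheses are available, and let $\mathbb E(\tau_k)=\int \mathbb E(\tau_k\mid p)\,f_p(p)\,dp$. (a) Suppose in addition that the marginal distribution function $F$ of $p_m$ is differentiable at $\alpha_m$ with $F'(\alpha_m)>0$, and that there are $\gamma,d>0$ such that $F$ is differentiable with $F'\ge d$ on $(\alpha_m,\alpha_m+\gamma)$. Then every Monte Carlo algorithm that guarantees correctness at level $1-\epsilon$ for the step-up procedure satisfies $\mathbb E(\tau_k)=\infty$ for all $1\le k\le m$; in particular, the expected runtime before reaching any decision at all is infinite. (b) Every Monte Carlo algorithm that guarantees correctness at level $1-\epsilon$ for the step-down procedure likewise satisfies $\mathbb E(\tau_k)=\infty$ for all $1\le k\le m$. -/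

import Mathlib

open MeasureTheory ProbabilityTheory
open scoped unitInterval ENNReal NNReal

noncomputable section

namespace MonteCarloTesting

/-! ### Step-up and step-down procedures

`p : Fin m → I` is a vector of p-values in `[0,1]` and `α : Fin m → ℝ` the vector of thresholds,
both indexed from `0`. -/

/-- The order statistics `p_(0) ≤ p_(1) ≤ ⋯ ≤ p_(m-1)` of `p`. -/
def orderStat {m : ℕ} (p : Fin m → I) : Fin m → I := p ∘ Tuple.sort p

/-- `H_i` is rejected by the step-up procedure: with `k` the largest index such that
`p_(k) ≤ α_k`, the hypotheses with p-values `p_(0), …, p_(k)` are rejected (none if there is no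
such `k`). Equivalently, `p_i ≤ p_(k)` for some `k` with `p_(k) ≤ α_k`. -/
def StepUpRejects {m : ℕ} (α : Fin m → ℝ) (p : Fin m → I) (i : Fin m) : Prop :=
  ∃ k, p i ≤ orderStat p k ∧ (orderStat p k : ℝ) ≤ α k

/-- `H_i` is rejected by the step-down procedure: with `k` the smallest index such that
`p_(k) > α_k`, the hypotheses with p-values `p_(0), …, p_(k-1)` are rejected (all of them if there
is no such `k`). Equivalently, `p_(k) ≤ α_k` for all `k` with `p_(k) ≤ p_i`; for strictly
increasing thresholds, ties are harmless. -/
def StepDownRejects {m : ℕ} (α : Fin m → ℝ) (p : Fin m → I) (i : Fin m) : Prop :=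
  ∀ k, orderStat p k ≤ p i → (orderStat p k : ℝ) ≤ α k

/-! ### Conditions on the distribution of the p-values -/

/-- `μ` is a probability distribution on `[0,1]^m` with a density `f` with respect to Lebesgue
measure, and for every `δ > 0` this density exceeds some `κ > 0` on `[δ, 1 - δ]^m`. -/
def JointDensityCondition {m : ℕ} (μ : Measure (Fin m → I)) : Prop :=
  IsProbabilityMeasure μ ∧
    ∃ f : (Fin m → I) → ℝ≥0, Measurable f ∧ μ = volume.withDensity (fun p => (f p : ℝ≥0∞)) ∧
      ∀ δ : ℝ, 0 < δ → ∃ κ : ℝ≥0, 0 < κ ∧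
        ∀ p : Fin m → I, (∀ i, (p i : ℝ) ∈ Set.Icc δ (1 - δ)) → κ < f p

/-- The distribution function `F` of `ν` has a derivative `F'(a) > 0` at `a`, and there are
`γ, d > 0` such that `F' ≥ d` in `(a, a + γ)`. -/
def MarginalCondition (ν : Measure ℝ) (a : ℝ) : Prop :=
  DifferentiableAt ℝ (cdf ν) a ∧ 0 < deriv (cdf ν) a ∧
    ∃ γ : ℝ, 0 < γ ∧ ∃ d : ℝ, 0 < d ∧ ∀ x ∈ Set.Ioo a (a + γ),
      DifferentiableAt ℝ (cdf ν) x ∧ d ≤ deriv (cdf ν) x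

/-! ### Sequential Monte Carlo algorithms -/

/-- A (possibly randomised) sequential Monte Carlo algorithm for `m` hypotheses.

The internal randomness is a seed in `S`. A history is the list of the simulations carried out so
far, most recent first: the entry `(i, b)` records a simulation for `H_i` with outcome `b`
(`true` is an exceedance). Given seed and history, `next` is the hypothesis for which the next
simulation is drawn, and `decision s h i` is the decision on `H_i` announced at that moment:
`none` (no decision), `some true` (`H_i` is rejected) or `some false` (`H_i` is not rejected).
Announced decisions may be, but are not required to be, final. -/
structure Algorithm (m : ℕ) (S : Type*) [MeasurableSpace S] where
  seedLaw : Measure S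
  isProbabilityMeasure_seedLaw : IsProbabilityMeasure seedLaw
  next : S → List (Fin m × Bool) → Fin m
  decision : S → List (Fin m × Bool) → Fin m → Option Bool
  measurableSet_next : ∀ h i, MeasurableSet {s | next s h = i}
  measurableSet_decision : ∀ h i d, MeasurableSet {s | decision s h i = d}

namespace Algorithm

variable {m : ℕ} {S : Type*} [MeasurableSpace S] (𝒜 : Algorithm m S)

/-- Law of the seed and the simulation outcomes when the p-values are `p`. The outcome
`ω.2 n i` is that of simulation number `n` in case it is carried out for `H_i`; it is `true` with
probability `p i`. All outcomes and the seed are independent. -/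
def runLaw (p : Fin m → I) : Measure (S × (ℕ → Fin m → Bool)) :=
  𝒜.seedLaw.prod
    (Measure.infinitePi fun _ : ℕ => Measure.pi fun i => bernoulliMeasure true false (p i))

/-- The history after `n` simulations. -/
def history (ω : S × (ℕ → Fin m → Bool)) : ℕ → List (Fin m × Bool)
  | 0 => []
  | n + 1 =>
    let i := 𝒜.next ω.1 (history ω n)
    (i, ω.2 n i) :: history ω n

/-- The decision on `H_i` announced after `n` simulations, if any. -/
def decisionAt (ω : S × (ℕ → Fin m → Bool)) (n : ℕ) (i : Fin m) : Option Bool :=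
  𝒜.decision ω.1 (𝒜.history ω n) i

/-- The algorithm guarantees correctness at level `1 - ε` for the testing procedure `rejects`:
whatever the p-values, with probability at least `1 - ε` all decisions announced at any time on
any hypothesis agree with those of the procedure applied to the true p-values. -/
def GuaranteesCorrectness (rejects : (Fin m → I) → Fin m → Prop) (ε : ℝ) : Prop :=
  ∀ p : Fin m → I, 1 - ε ≤ (𝒜.runLaw p).real
    {ω | ∀ n i b, 𝒜.decisionAt ω n i = some b → (b = true ↔ rejects p i)}

/-- The number of simulations until decisions on at least `k` hypotheses are available
(`∞` if this never happens). -/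
def runtime (k : ℕ) (ω : S × (ℕ → Fin m → Bool)) : ℝ≥0∞ :=
  ⨅ (n : ℕ) (_ : k ≤ (Finset.univ.filter fun i => (𝒜.decisionAt ω n i).isSome).card), (n : ℝ≥0∞)

/-- The expected number of simulations until decisions on at least `k` hypotheses are available,
when the vector of p-values is drawn from `μ`: `∫ E(runtime | p) dμ(p)`. -/
def expectedRuntime (μ : Measure (Fin m → I)) (k : ℕ) : ℝ≥0∞ :=
  ∫⁻ p, ∫⁻ ω, 𝒜.runtime k ω ∂(𝒜.runLaw p) ∂μ

end Algorithm

end MonteCarloTesting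

end

noncomputable section

namespace MonteCarloTesting

/-! ### Order statistics -/

/-! Each procedure has a threshold at which moving a single p-value flips every decision at once.
For step-up, keep all other p-values below the top threshold `α j` but above all lower thresholds:
if `p j = α j` everything is rejected, and as soon as `p j > α j` nothing is. Step-down is the
mirror image at the lowest threshold, with the other p-values above it and below the remaining ones.

Near such a point even one announced decision separates `p` from the vector `q` obtained by moving
`p j` to the threshold. Driving both runs by the same seed and uniforms, each simulation
distinguishes them with probability at most `d = p j - q j`, so with probability at least `1 - 2ε -
n d` nothing is announced up to time `n` (`le_undecided`). Taking `n` of order `1 / d` bounds the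
conditional expected runtime below by a constant times `1 / d` (`le_lintegral_runtime`). The density
is bounded below on a box with a face on the threshold, and `1 / d` is not integrable there
(`setLIntegral_box_eq_top`). -/

lemma orderStat_monotone {m : ℕ} (p : Fin m → I) : Monotone (orderStat p) :=
  Tuple.monotone_sort p

lemma exists_orderStat_eq {m : ℕ} (p : Fin m → I) (i : Fin m) : ∃ k, orderStat p k = p i :=
  ⟨(Tuple.sort p).symm i, by simp [orderStat]⟩

lemma le_orderStat_of_forall_le {m : ℕ} (p : Fin m → I) {k : Fin m} (hk : ∀ l, l ≤ k)
    (i : Fin m) : p i ≤ orderStat p k := by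
  obtain ⟨l, hl⟩ := exists_orderStat_eq p i
  exact hl ▸ orderStat_monotone p (hk l)

lemma orderStat_le_of_forall_le {m : ℕ} (p : Fin m → I) {k : Fin m} (hk : ∀ l, k ≤ l)
    (i : Fin m) : orderStat p k ≤ p i := by
  obtain ⟨l, hl⟩ := exists_orderStat_eq p i
  exact hl ▸ orderStat_monotone p (hk l)

/-! ### Divergence of the integral of `1 / (x - a)` -/

lemma setLIntegral_Ioo_div_sub_eq_top {a b c : ℝ} (hab : a < b) (hc : 0 < c) :
    ∫⁻ x in Set.Ioo a b, ENNReal.ofReal (c / (x - a)) = ⊤ := by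
  by_contra h
  have hnn : 0 ≤ᵐ[volume.restrict (Set.Ioo a b)] fun x => c / (x - a) := by
    filter_upwards [ae_restrict_mem measurableSet_Ioo] with x hx
    exact div_nonneg hc.le (sub_nonneg.2 hx.1.le)
  have hint : IntegrableOn (fun x => c / (x - a)) (Set.Ioo a b) :=
    ⟨Measurable.aestronglyMeasurable (by fun_prop), (hasFiniteIntegral_iff_ofReal hnn).2 (lt_top_iff_ne_top.2 h)⟩
  have hint' : IntervalIntegrable (fun x => (x - a)⁻¹) volume a b := by
    rw [intervalIntegrable_iff_integrableOn_Ioo_of_le hab.le]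
    refine (hint.const_mul c⁻¹).congr (Filter.Eventually.of_forall fun x => ?_)
    simp only [div_eq_mul_inv]
    rw [← mul_assoc, inv_mul_cancel₀ hc.ne', one_mul]
  -- Integrability would force `a = b` or the pole `a` to lie outside the closed interval, but `a`
  -- is an endpoint.
  rw [intervalIntegrable_sub_inv_iff] at hint'
  rcases hint' with h | h
  · exact hab.ne h
  · exact h Set.left_mem_uIcc

lemma unitInterval_setLIntegral_Ioo_div_sub_eq_top {a b c : ℝ} (ha : 0 ≤ a) (hb : b ≤ 1)
    (hab : a < b) (hc : 0 < c) :
    ∫⁻ x : I in Subtype.val ⁻¹' Set.Ioo a b, ENNReal.ofReal (c / ((x : ℝ) - a)) = ⊤ := by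
  rw [unitInterval.measurePreserving_coe.setLIntegral_comp_preimage measurableSet_Ioo
      (f := fun x : ℝ => ENNReal.ofReal (c / (x - a))) (by fun_prop),
    Measure.restrict_restrict measurableSet_Ioo, Set.inter_eq_left.2
      (Set.Ioo_subset_Icc_self.trans (Set.Icc_subset_Icc ha hb))]
  exact setLIntegral_Ioo_div_sub_eq_top hab hc

/-- The box of all `p` with `p j ∈ (a, b)` and the other entries in `(l, u)`. -/
def box {m : ℕ} (j : Fin m) (a b l u : ℝ) : Set (Fin m → I) :=
  Set.univ.pi fun i => Subtype.val ⁻¹' (if i = j then Set.Ioo a b else Set.Ioo l u)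

lemma measurableSet_box {m : ℕ} (j : Fin m) (a b l u : ℝ) : MeasurableSet (box j a b l u) := by
  refine MeasurableSet.univ_pi fun i => measurable_subtype_coe ?_
  split_ifs <;> exact measurableSet_Ioo

lemma mem_box {m : ℕ} {j : Fin m} {a b l u : ℝ} {p : Fin m → I} :
    p ∈ box j a b l u ↔
      (p j : ℝ) ∈ Set.Ioo a b ∧ ∀ i, i ≠ j → (p i : ℝ) ∈ Set.Ioo l u := by
  simp only [box, Set.mem_univ_pi, Set.mem_preimage]
  refine ⟨fun h => ⟨by simpa using h j, fun i hi => by simpa [hi] using h i⟩, fun h i => ?_⟩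
  split_ifs with hi
  · exact hi ▸ h.1
  · exact h.2 i hi

lemma volume_preimage_Ioo_ne_zero {l u : ℝ} (hl : 0 ≤ l) (hu : u ≤ 1) (hlu : l < u) :
    (volume : Measure I) (Subtype.val ⁻¹' Set.Ioo l u) ≠ 0 := by
  rw [unitInterval.measurePreserving_coe.measure_preimage measurableSet_Ioo.nullMeasurableSet,
    Measure.restrict_apply measurableSet_Ioo, Set.inter_eq_left.2
      (Set.Ioo_subset_Icc_self.trans (Set.Icc_subset_Icc hl hu)), Real.volume_Ioo]
  simpa using hlu

/-- The integrand depends on coordinate `j` alone, so pushing forward along it leaves the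
one-dimensional integral times the product of the other side lengths; only its being nonzero
matters. -/
lemma setLIntegral_box_div_sub_eq_top {m : ℕ} (j : Fin m) {a b l u c : ℝ} (ha : 0 ≤ a)
    (hb : b ≤ 1) (hab : a < b) (hl : 0 ≤ l) (hu : u ≤ 1) (hlu : l < u) (hc : 0 < c) :
    ∫⁻ p in box j a b l u, ENNReal.ofReal (c / ((p j : ℝ) - a)) = ⊤ := by
  have hmap := lintegral_map
    (μ := Measure.pi fun i : Fin m => (volume : Measure I).restrict
      (Subtype.val ⁻¹' (if i = j then Set.Ioo a b else Set.Ioo l u)))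
    (f := fun x : I => ENNReal.ofReal (c / ((x : ℝ) - a)))
    (g := Function.eval j) (by fun_prop) (by fun_prop)
  rw [box, volume_pi, Measure.restrict_pi_pi]
  refine hmap.symm.trans ?_
  rw [Measure.pi_map_eval, lintegral_smul_measure]
  simp only [if_true]
  rw [unitInterval_setLIntegral_Ioo_div_sub_eq_top ha hb hab hc, smul_eq_mul,
    ENNReal.mul_top]
  refine Finset.prod_ne_zero_iff.2 fun i hi => ?_
  simp only [Finset.ne_of_mem_erase hi, if_false, Measure.restrict_apply_univ]
  exact volume_preimage_Ioo_ne_zero hl hu hlu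

lemma JointDensityCondition.setLIntegral_box_eq_top {m : ℕ} {μ : Measure (Fin m → I)}
    (hμ : JointDensityCondition μ) (j : Fin m) {a b l u c : ℝ} (ha : 0 < a)
    (hb : b < 1) (hab : a < b) (hl : 0 < l) (hu : u < 1) (hlu : l < u) (hc : 0 < c) :
    ∫⁻ p in box j a b l u, ENNReal.ofReal (c / ((p j : ℝ) - a)) ∂μ = ⊤ := by
  obtain ⟨-, f, hf, rfl, hlow⟩ := hμ
  -- This `δ` places the whole box inside `[δ, 1 - δ]^m`.
  obtain ⟨κ, hκ, hκf⟩ := hlow (min (min a (1 - b)) (min l (1 - u)))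
    (by simp [ha, hb, hl, hu])
  have hbox := measurableSet_box j a b l u
  rw [setLIntegral_withDensity_eq_setLIntegral_mul _ (by fun_prop) (by fun_prop) hbox,
    eq_top_iff]
  calc (⊤ : ℝ≥0∞)
      = κ * ∫⁻ p in box j a b l u, ENNReal.ofReal (c / ((p j : ℝ) - a)) := by
        rw [setLIntegral_box_div_sub_eq_top j ha.le hb.le hab hl.le hu.le hlu hc,
          ENNReal.mul_top (by simpa using hκ.ne')]
    _ = ∫⁻ p in box j a b l u, κ * ENNReal.ofReal (c / ((p j : ℝ) - a)) := by
        rw [lintegral_const_mul _ (by fun_prop)]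
    _ ≤ _ := by
        refine setLIntegral_mono' hbox fun p hp => ?_
        rw [mem_box] at hp
        refine mul_le_mul_left (ENNReal.coe_le_coe.2 (hκf p fun i => ?_).le) _
        have h1 := min_le_left (min a (1 - b)) (min l (1 - u))
        have h2 := min_le_right (min a (1 - b)) (min l (1 - u))
        have h3 := min_le_left a (1 - b)
        have h4 := min_le_right a (1 - b)
        have h5 := min_le_left l (1 - u)
        have h6 := min_le_right l (1 - u)
        by_cases hi : i = j
        · subst hi
          constructor <;> linarith [hp.1.1, hp.1.2]
        · have := hp.2 i hi
          constructor <;> linarith [this.1, this.2]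

/-! ### Coupling of the simulations for different p-values -/

/-- The outcomes of all simulations as a function of uniform random variables. -/
def outcomes {m : ℕ} (p : Fin m → I) (U : ℕ → Fin m → I) : ℕ → Fin m → Bool :=
  fun n i => decide (U n i ≤ p i)

lemma measurable_decide_le (x : I) : Measurable fun u : I => decide (u ≤ x) :=
  measurable_to_bool (by
    convert! (measurableSet_Iic : MeasurableSet (Set.Iic x)) using 1
    ext u; simp)

lemma map_decide_le (x : I) :
    (volume : Measure I).map (fun u => decide (u ≤ x)) = bernoulliMeasure true false x := by
  refine Measure.ext_of_singleton fun b => ?_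
  rw [Measure.map_apply (measurable_decide_le x) (measurableSet_singleton b)]
  cases b
  · have : (fun u : I => decide (u ≤ x)) ⁻¹' {false} = Set.Ioi x := by ext u; simp
    rw [this, unitInterval.volume_Ioi, bernoulliMeasure_apply_of_notMem_of_mem _ (by simp)
      (by simp) (by simp), ENNReal.ofReal, ← unitInterval.coe_symm_eq, ← unitInterval.coe_toNNReal,
      Real.toNNReal_coe]
  · have : (fun u : I => decide (u ≤ x)) ⁻¹' {true} = Set.Iic x := by ext u; simp
    rw [this, unitInterval.volume_Iic, bernoulliMeasure_apply_of_mem_of_notMem _ (by simp)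
      (by simp) (by simp), ENNReal.ofReal, ← unitInterval.coe_toNNReal, Real.toNNReal_coe]

lemma measurable_outcomes {m : ℕ} (p : Fin m → I) : Measurable (outcomes p) :=
  measurable_pi_lambda _ fun n => measurable_pi_lambda _ fun i =>
    (measurable_decide_le (p i)).comp ((measurable_pi_apply i).comp (measurable_pi_apply n))

lemma map_outcomes {m : ℕ} (p : Fin m → I) :
    (Measure.infinitePi fun _ : ℕ => Measure.pi fun _ : Fin m => (volume : Measure I)).map
        (outcomes p) =
      Measure.infinitePi fun _ : ℕ => Measure.pi fun i => bernoulliMeasure true false (p i) := by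
  have hmeas : Measurable fun (x : Fin m → I) i => decide (x i ≤ p i) :=
    measurable_pi_lambda _ fun i => (measurable_decide_le (p i)).comp (measurable_pi_apply i)
  have hpi : (Measure.pi fun _ : Fin m => (volume : Measure I)).map
      (fun x i => decide (x i ≤ p i)) = Measure.pi fun i => bernoulliMeasure true false (p i) := by
    have (i : Fin m) : IsProbabilityMeasure
        ((volume : Measure I).map fun u => decide (u ≤ p i)) :=
      Measure.isProbabilityMeasure_map (measurable_decide_le _).aemeasurable
    rw [Measure.pi_map_pi fun i => (measurable_decide_le (p i)).aemeasurable]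
    simp_rw [map_decide_le]
  have := Measure.infinitePi_map_pi
    (fun _ : ℕ => Measure.pi fun _ : Fin m => (volume : Measure I)) (fun _ => hmeas)
  simp_rw [hpi] at this
  exact this

namespace Algorithm

variable {m : ℕ} {S : Type*} [MeasurableSpace S] (𝒜 : Algorithm m S)

/-- Law of the seed and of the uniform random variables that drive the simulations. -/
def uniformLaw : Measure (S × (ℕ → Fin m → I)) :=
  𝒜.seedLaw.prod (Measure.infinitePi fun _ : ℕ => Measure.pi fun _ : Fin m => volume)

instance isProbabilityMeasure_uniformLaw : IsProbabilityMeasure 𝒜.uniformLaw := by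
  have := 𝒜.isProbabilityMeasure_seedLaw
  unfold uniformLaw
  infer_instance

lemma measurable_prodMap_outcomes (p : Fin m → I) :
    Measurable (Prod.map id (outcomes p) : S × (ℕ → Fin m → I) → S × (ℕ → Fin m → Bool)) :=
  measurable_id.prodMap (measurable_outcomes p)

/-- Runs for all `p` thus live on one probability space, where they can be compared pointwise. -/
lemma map_uniformLaw (p : Fin m → I) :
    𝒜.uniformLaw.map (Prod.map id (outcomes p)) = 𝒜.runLaw p := by
  have := 𝒜.isProbabilityMeasure_seedLaw
  rw [uniformLaw, runLaw, ← Measure.map_prod_map _ _ measurable_id (measurable_outcomes p),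
    Measure.map_id, map_outcomes]

lemma runLaw_real_apply (p : Fin m → I) {E : Set (S × (ℕ → Fin m → Bool))}
    (hE : MeasurableSet E) :
    (𝒜.runLaw p).real E = 𝒜.uniformLaw.real (Prod.map id (outcomes p) ⁻¹' E) := by
  rw [← map_uniformLaw, map_measureReal_apply (measurable_prodMap_outcomes p) hE]

lemma uniformLaw_real_Ioc (n : ℕ) (j : Fin m) {x y : I} (hxy : x ≤ y) :
    𝒜.uniformLaw.real {ω | ω.2 n j ∈ Set.Ioc x y} = y - x := by
  have := 𝒜.isProbabilityMeasure_seedLaw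
  have hmp : MeasurePreserving (fun ω : S × (ℕ → Fin m → I) => ω.2 n j) 𝒜.uniformLaw volume :=
    (measurePreserving_eval (fun _ : Fin m => (volume : Measure I)) j).comp
      ((measurePreserving_eval_infinitePi
        (fun _ : ℕ => Measure.pi fun _ : Fin m => (volume : Measure I)) n).comp
        measurePreserving_snd)
  have h := hmp.measureReal_preimage (s := Set.Ioc x y) measurableSet_Ioc.nullMeasurableSet
  rw [show {ω : S × (ℕ → Fin m → I) | ω.2 n j ∈ Set.Ioc x y} =
    (fun ω => ω.2 n j) ⁻¹' Set.Ioc x y from rfl, h, measureReal_def, unitInterval.volume_Ioc,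
    ENNReal.toReal_ofReal (sub_nonneg.2 hxy)]

/-! ### Measurability and locality of the history -/

/-- The predicate may depend on `ω` as well, so that the induction can absorb the latest simulation
into it and descend to the empty history. -/
lemma measurableSet_history (n : ℕ) (P : S × (ℕ → Fin m → Bool) → List (Fin m × Bool) → Prop)
    (hP : ∀ h, MeasurableSet {ω | P ω h}) : MeasurableSet {ω | P ω (𝒜.history ω n)} := by
  induction n generalizing P with
  | zero => exact hP []
  | succ n ih =>
    refine ih (fun ω h => P ω ((𝒜.next ω.1 h, ω.2 n (𝒜.next ω.1 h)) :: h)) fun h => ?_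
    have : {ω : S × (ℕ → Fin m → Bool) | P ω ((𝒜.next ω.1 h, ω.2 n (𝒜.next ω.1 h)) :: h)} =
        ⋃ i, ⋃ b, (Prod.fst ⁻¹' {s | 𝒜.next s h = i} ∩
          {ω : S × (ℕ → Fin m → Bool) | ω.2 n i = b}) ∩
          {ω | P ω ((i, b) :: h)} := by
      ext ω
      simp only [Set.mem_ofPred_eq, Set.mem_iUnion, Set.mem_inter_iff, Set.mem_preimage]
      exact ⟨fun hω => ⟨_, _, ⟨rfl, rfl⟩, hω⟩, fun ⟨i, b, ⟨hi, hb⟩, hω⟩ => by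
        subst hi hb
        exact hω⟩
    rw [this]
    refine MeasurableSet.iUnion fun i => MeasurableSet.iUnion fun b => ?_
    refine ((measurable_fst (𝒜.measurableSet_next h i)).inter ?_).inter (hP _)
    have : Measurable fun ω : S × (ℕ → Fin m → Bool) => ω.2 n i := by fun_prop
    exact this (measurableSet_singleton b)

lemma measurableSet_decisionAt (n : ℕ) (i : Fin m) (d : Option Bool) :
    MeasurableSet {ω | 𝒜.decisionAt ω n i = d} :=
  𝒜.measurableSet_history n (fun ω h => 𝒜.decision ω.1 h i = d)
    fun h => measurable_fst (𝒜.measurableSet_decision h i d)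

lemma measurableSet_forall_decisionAt (Q : Fin m → Bool → Prop) :
    MeasurableSet {ω | ∀ n i b, 𝒜.decisionAt ω n i = some b → Q i b} := by
  have : {ω | ∀ n i b, 𝒜.decisionAt ω n i = some b → Q i b} =
      ⋂ n, ⋂ i, ⋂ b, ({ω | 𝒜.decisionAt ω n i = some b}ᶜ ∪ {_ω | Q i b}) := by
    ext ω
    simp [imp_iff_not_or]
  rw [this]
  exact MeasurableSet.iInter fun n => MeasurableSet.iInter fun i => MeasurableSet.iInter fun b =>
    (𝒜.measurableSet_decisionAt n i _).compl.union (MeasurableSet.const _)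

/-- The event that no decision is announced during the first `n` simulations. -/
def undecided (n : ℕ) : Set (S × (ℕ → Fin m → Bool)) :=
  {ω | ∀ k ≤ n, ∀ i, 𝒜.decisionAt ω k i = none}

lemma measurableSet_undecided (n : ℕ) : MeasurableSet (𝒜.undecided n) := by
  have : 𝒜.undecided n = ⋂ k, ⋂ (_ : k ≤ n), ⋂ i, {ω | 𝒜.decisionAt ω k i = none} := by
    ext ω
    simp [undecided]
  rw [this]
  exact MeasurableSet.iInter fun k => MeasurableSet.iInter fun _ => MeasurableSet.iInter fun i =>
    𝒜.measurableSet_decisionAt k i none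

lemma history_congr {ω ω' : S × (ℕ → Fin m → Bool)} {n : ℕ} (h1 : ω.1 = ω'.1)
    (h2 : ∀ k < n, ω.2 k = ω'.2 k) : 𝒜.history ω n = 𝒜.history ω' n := by
  induction n with
  | zero => rfl
  | succ n ih =>
    simp only [history, ih fun k hk => h2 k (hk.trans n.lt_succ_self), h1, h2 n n.lt_succ_self]

/-! ### Lower bounds for the runtime -/

/-- If the correct decisions for `q` and `p` are opposite on all hypotheses and `q`, `p` differ
only in one entry, then `p` and `q` cannot be told apart with few simulations. -/
lemma GuaranteesCorrectness.le_undecided {rejects : (Fin m → I) → Fin m → Prop} {ε : ℝ}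
    {𝒜 : Algorithm m S} (h𝒜 : 𝒜.GuaranteesCorrectness rejects ε) {q p : Fin m → I} {j : Fin m}
    (hqp : ∀ i, i ≠ j → q i = p i) (hj : q j ≤ p j) (hq : ∀ i, rejects q i)
    (hp : ∀ i, ¬ rejects p i) (n : ℕ) :
    1 - 2 * ε - n * ((p j : ℝ) - q j) ≤ (𝒜.runLaw p).real (𝒜.undecided n) := by
  have key (r : Fin m → I) := 𝒜.runLaw_real_apply r
    (𝒜.measurableSet_forall_decisionAt fun i b => (b = true ↔ rejects r i))
  set G : (Fin m → I) → Set (S × (ℕ → Fin m → I)) := fun r => Prod.map id (outcomes r) ⁻¹'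
    {ω | ∀ n i b, 𝒜.decisionAt ω n i = some b → (b = true ↔ rejects r i)}
  have hGm (r : Fin m → I) : MeasurableSet (G r) := measurable_prodMap_outcomes r
    (𝒜.measurableSet_forall_decisionAt fun i b => (b = true ↔ rejects r i))
  have hGle (r : Fin m → I) : 𝒜.uniformLaw.real (G r)ᶜ ≤ ε := by
    have h1 := h𝒜 r
    rw [key r] at h1
    rw [probReal_compl_eq_one_sub (hGm r)]
    linarith
  -- The event that a uniform for `j` separates `q j` from `p j` before time `n`, whether or not
  -- `H_j` is the hypothesis simulated then.
  set T : Set (S × (ℕ → Fin m → I)) :=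
    ⋃ k ∈ Finset.range n, {ω | ω.2 k j ∈ Set.Ioc (q j) (p j)} with hT
  have hTle : 𝒜.uniformLaw.real T ≤ n * ((p j : ℝ) - q j) := by
    refine (measureReal_biUnion_finset_le _ _).trans ?_
    simp only [𝒜.uniformLaw_real_Ioc _ j hj]
    rw [Finset.sum_const, Finset.card_range, nsmul_eq_mul]
  rw [𝒜.runLaw_real_apply p (𝒜.measurableSet_undecided n)]
  set E := (Prod.map id (outcomes p) ⁻¹' 𝒜.undecided n : Set (S × (ℕ → Fin m → I)))
  -- Outside these three events both runs have the same history up to time `n` and are both correct,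
  -- so any announced decision would have to be both a rejection and a non-rejection.
  have hcover : Eᶜ ⊆ ((G q)ᶜ ∪ (G p)ᶜ) ∪ T := by
    intro ω hω
    by_contra hcon
    simp only [Set.mem_union, Set.mem_compl_iff, not_or, not_not] at hcon
    obtain ⟨⟨hωq, hωp⟩, hωT⟩ := hcon
    refine hω fun k hk i => ?_
    have hout : ∀ l < k, outcomes q ω.2 l = outcomes p ω.2 l := by
      intro l hl
      funext i
      by_cases hi : i = j
      · subst hi
        have hnot : ¬ (q i < ω.2 l i ∧ ω.2 l i ≤ p i) := fun h => hωT (by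
          simp only [hT, Set.mem_iUnion]
          exact ⟨l, Finset.mem_range.2 (hl.trans_le hk), h⟩)
        simp only [outcomes, decide_eq_decide]
        exact ⟨fun h => h.trans hj, fun h => not_lt.1 fun h' => hnot ⟨h', h⟩⟩
      · simp [outcomes, hqp i hi]
    have hdec : 𝒜.decisionAt (Prod.map id (outcomes q) ω) k i =
        𝒜.decisionAt (Prod.map id (outcomes p) ω) k i := by
      simp only [decisionAt]
      rw [𝒜.history_congr (ω := Prod.map id (outcomes q) ω) (ω' := Prod.map id (outcomes p) ω)
        rfl hout]
      rfl
    cases hd : 𝒜.decisionAt (Prod.map id (outcomes p) ω) k i with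
    | none => rfl
    | some b =>
      have h1 := (hωp k i b hd).1
      have h2 := (hωq k i b (hdec.trans hd)).2 (hq i)
      exact absurd (h1 h2) (hp i)
  have hEm : MeasurableSet E := measurable_prodMap_outcomes p (𝒜.measurableSet_undecided n)
  have h1 := (measureReal_mono (μ := 𝒜.uniformLaw) hcover).trans
    ((measureReal_union_le _ _).trans (add_le_add (measureReal_union_le _ _) le_rfl))
  rw [probReal_compl_eq_one_sub hEm] at h1
  linarith [hGle q, hGle p]

lemma le_runtime_of_mem_undecided {n k : ℕ} (hk : 1 ≤ k) {ω : S × (ℕ → Fin m → Bool)}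
    (hω : ω ∈ 𝒜.undecided n) : ((n + 1 : ℕ) : ℝ≥0∞) ≤ 𝒜.runtime k ω := by
  refine le_iInf₂ fun l hl => Nat.cast_le.2 (Nat.succ_le_of_lt (not_le.1 fun hln => ?_))
  have : (Finset.univ.filter fun i => (𝒜.decisionAt ω l i).isSome) = ∅ := by
    simp [hω l hln]
  rw [this, Finset.card_empty] at hl
  omega

/-- The conditional expected runtime near a point where all decisions flip is at least of the
order of the inverse distance. -/
lemma GuaranteesCorrectness.le_lintegral_runtime {rejects : (Fin m → I) → Fin m → Prop} {ε : ℝ}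
    (hε : ε < 1 / 2) {𝒜 : Algorithm m S} (h𝒜 : 𝒜.GuaranteesCorrectness rejects ε)
    {q p : Fin m → I} {j : Fin m} (hqp : ∀ i, i ≠ j → q i = p i) (hj : q j < p j)
    (hq : ∀ i, rejects q i) (hp : ∀ i, ¬ rejects p i) {k : ℕ} (hk : 1 ≤ k) :
    ENNReal.ofReal ((1 / 2 - ε) ^ 2 / ((p j : ℝ) - q j)) ≤
      ∫⁻ ω, 𝒜.runtime k ω ∂(𝒜.runLaw p) := by
  have hη : 0 < 1 / 2 - ε := by linarith
  have hd : 0 < (p j : ℝ) - q j := sub_pos.2 hj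
  set η := 1 / 2 - ε with hη_def
  set d := (p j : ℝ) - q j with hd_def
  -- Since `1 - 2ε = 2η`, the bound `n d ≤ η` leaves probability at least `η` of no decision through
  -- time `n`; the runtime is then at least `n + 1 ≥ η / d`.
  set n := ⌊η / d⌋₊
  have hn : n * d ≤ η := (le_div_iff₀ hd).1 (Nat.floor_le (by positivity))
  have hn' : η / d ≤ (n + 1 : ℕ) := by exact_mod_cast (Nat.lt_floor_add_one (η / d)).le
  have hprob : η ≤ (𝒜.runLaw p).real (𝒜.undecided n) := by
    have := h𝒜.le_undecided hqp hj.le hq hp n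
    linarith
  calc ENNReal.ofReal (η ^ 2 / d)
      = ENNReal.ofReal (η / d) * ENNReal.ofReal η := by
        rw [← ENNReal.ofReal_mul (by positivity)]
        congr 1
        ring
    _ ≤ ((n + 1 : ℕ) : ℝ≥0∞) * (𝒜.runLaw p) (𝒜.undecided n) := by
        refine mul_le_mul' ?_ ?_
        · rw [← ENNReal.ofReal_natCast]
          exact ENNReal.ofReal_le_ofReal hn'
        · exact (ENNReal.ofReal_le_ofReal hprob).trans ENNReal.ofReal_toReal_le
    _ = ∫⁻ _ in 𝒜.undecided n, ((n + 1 : ℕ) : ℝ≥0∞) ∂(𝒜.runLaw p) := by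
        rw [setLIntegral_const]
    _ ≤ ∫⁻ ω in 𝒜.undecided n, 𝒜.runtime k ω ∂(𝒜.runLaw p) :=
        setLIntegral_mono' (𝒜.measurableSet_undecided n)
          fun ω hω => 𝒜.le_runtime_of_mem_undecided hk hω
    _ ≤ _ := setLIntegral_le_lintegral _ _

/-- If all decisions flip as one p-value crosses a threshold while the others vary in an open
box, then the expected time to the first decision is infinite. -/
lemma GuaranteesCorrectness.expectedRuntime_eq_top {rejects : (Fin m → I) → Fin m → Prop} {ε : ℝ}
    (hε : ε < 1 / 2) {𝒜 : Algorithm m S} (h𝒜 : 𝒜.GuaranteesCorrectness rejects ε)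
    {μ : Measure (Fin m → I)} (hμ : JointDensityCondition μ) (j : Fin m) {a l u : ℝ}
    (ha : a ∈ Set.Ioo (0 : ℝ) 1) (hl : 0 < l) (hu : u < 1) (hlu : l < u)
    (hrej : ∀ q : Fin m → I, (q j : ℝ) = a → (∀ i, i ≠ j → (q i : ℝ) ∈ Set.Ioo l u) →
      ∀ i, rejects q i)
    (hnot : ∀ p : Fin m → I, a < p j → (∀ i, i ≠ j → (p i : ℝ) ∈ Set.Ioo l u) →
      ∀ i, ¬ rejects p i) {k : ℕ} (hk : 1 ≤ k) :
    𝒜.expectedRuntime μ k = ⊤ := by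
  obtain ⟨b, hab, hb⟩ := exists_between ha.2
  have hη : 0 < (1 / 2 - ε) ^ 2 := by
    have : 0 < 1 / 2 - ε := by linarith
    positivity
  rw [eq_top_iff, ← hμ.setLIntegral_box_eq_top j ha.1 hb hab hl hu hlu hη]
  refine (setLIntegral_mono' (measurableSet_box j a b l u) fun p hp => ?_).trans
    (setLIntegral_le_lintegral _ _)
  rw [mem_box] at hp
  -- The comparison vector sits exactly on the threshold, where equality still counts as rejection.
  have hqp : ∀ i, i ≠ j → Function.update p j ⟨a, ha.1.le, ha.2.le⟩ i = p i :=
    fun i hi => Function.update_of_ne hi _ _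
  have := h𝒜.le_lintegral_runtime hε hqp (by simpa [← Subtype.coe_lt_coe] using hp.1.1)
    (hrej _ (by simp) fun i hi => by rw [hqp i hi]; exact hp.2 i hi)
    (hnot p hp.1.1 hp.2) hk
  simpa using this

end Algorithm

/-! ### Flipping all decisions of the step-up and step-down procedures -/

lemma stepUpRejects_of_forall_le {m : ℕ} {α : Fin m → ℝ} {p : Fin m → I} {j : Fin m}
    (hj : ∀ l, l ≤ j) (hp : ∀ i, (p i : ℝ) ≤ α j) (i : Fin m) : StepUpRejects α p i :=
  ⟨j, le_orderStat_of_forall_le p hj i, hp _⟩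

/-- The top rank fails because the maximum is at least `p j`; lower ranks fail because every p-value
exceeds their thresholds. -/
lemma not_stepUpRejects {m : ℕ} {α : Fin m → ℝ} {p : Fin m → I} {j : Fin m}
    (hj : ∀ l, l ≤ j) (hpj : α j < p j) (hp : ∀ i k, k ≠ j → α k < p i) (i : Fin m) :
    ¬ StepUpRejects α p i := by
  rintro ⟨k, -, hk⟩
  by_cases hkj : k = j
  · subst hkj
    exact (hpj.trans_le (le_orderStat_of_forall_le p hj k)).not_ge hk
  · exact (hp _ k hkj).not_ge hk

lemma stepDownRejects_of_le {m : ℕ} {α : Fin m → ℝ} {p : Fin m → I} {j : Fin m}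
    (hj : ∀ l, j ≤ l) (hpj : (p j : ℝ) ≤ α j) (hp : ∀ i k, k ≠ j → (p i : ℝ) ≤ α k)
    (i : Fin m) : StepDownRejects α p i := by
  intro k _
  by_cases hkj : k = j
  · subst hkj
    exact le_trans (orderStat_le_of_forall_le p hj k) hpj
  · exact hp _ k hkj

lemma not_stepDownRejects_of_forall_lt {m : ℕ} {α : Fin m → ℝ} {p : Fin m → I} {j : Fin m}
    (hj : ∀ l, j ≤ l) (hp : ∀ i, α j < p i) (i : Fin m) : ¬ StepDownRejects α p i :=
  fun h => (hp _).not_ge (h j (orderStat_le_of_forall_le p hj i))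

/-- Finitely many thresholds below `a` leave a gap under `a` for the other p-values; `b` keeps this
gap away from the boundary of `[0,1]`, even when there are no other thresholds. -/
lemma exists_between_of_forall_lt {m : ℕ} (α : Fin m → ℝ) (j : Fin m) {b a : ℝ} (hba : b < a)
    (h : ∀ k, k ≠ j → α k < a) : ∃ l, b < l ∧ l < a ∧ ∀ k, k ≠ j → α k ≤ l := by
  have hev : ∀ᶠ x in nhdsWithin a (Set.Iio a), x ∈ Set.Ioo b a ∧ ∀ k, k ≠ j → α k ≤ x := by
    refine Filter.Eventually.and (Ioo_mem_nhdsLT hba) (Filter.eventually_all.2 fun k => ?_)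
    by_cases hk : k = j
    · simp [hk]
    · filter_upwards [Ioo_mem_nhdsLT (h k hk)] with x hx _ using hx.1.le
  obtain ⟨l, hl, hlk⟩ := hev.exists
  exact ⟨l, hl.1, hl.2, hlk⟩

lemma exists_between_of_forall_gt {m : ℕ} (α : Fin m → ℝ) (j : Fin m) {a b : ℝ} (hab : a < b)
    (h : ∀ k, k ≠ j → a < α k) : ∃ u, a < u ∧ u < b ∧ ∀ k, k ≠ j → u ≤ α k := by
  obtain ⟨l, h1, h2, h3⟩ := exists_between_of_forall_lt (fun k => -α k) j (neg_lt_neg hab)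
    fun k hk => neg_lt_neg (h k hk)
  exact ⟨-l, lt_neg.1 h2, neg_lt.1 h1, fun k hk => neg_le.1 (h3 k hk)⟩

end MonteCarloTesting

end

theorem mainTheorem2 (m : ℕ) (hm : 0 < m)
    (α : Fin m → ℝ) (hα : StrictMono α) (hα01 : ∀ i, α i ∈ Set.Ioo (0 : ℝ) 1)
    (ε : ℝ) (hε : ε ∈ Set.Ioo (0 : ℝ) (1 / 2))
    (μ : MeasureTheory.Measure (Fin m → unitInterval))
    (hμ : MonteCarloTesting.JointDensityCondition μ)
    {S : Type*} [MeasurableSpace S] (𝒜 : MonteCarloTesting.Algorithm m S) :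
    (MonteCarloTesting.MarginalCondition
        (μ.map fun p => (p ⟨m - 1, Nat.sub_lt hm one_pos⟩ : ℝ))
        (α ⟨m - 1, Nat.sub_lt hm one_pos⟩) →
      𝒜.GuaranteesCorrectness (MonteCarloTesting.StepUpRejects α) ε →
      ∀ k : ℕ, 1 ≤ k → k ≤ m → 𝒜.expectedRuntime μ k = ⊤) ∧
    (𝒜.GuaranteesCorrectness (MonteCarloTesting.StepDownRejects α) ε →
      ∀ k : ℕ, 1 ≤ k → k ≤ m → 𝒜.expectedRuntime μ k = ⊤) := by
  constructor
  · intro _ h𝒜 k hk _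
    set j : Fin m := ⟨m - 1, Nat.sub_lt hm one_pos⟩
    have hj : ∀ l : Fin m, l ≤ j := fun l => Nat.le_sub_one_of_lt l.isLt
    obtain ⟨l, hl0, hla, hlk⟩ := MonteCarloTesting.exists_between_of_forall_lt α j (hα01 j).1
      fun k hk => hα (lt_of_le_of_ne (hj k) hk)
    -- The other p-values range over `(l, α j)`.
    refine h𝒜.expectedRuntime_eq_top hε.2 hμ j (hα01 j) hl0 (hα01 j).2 hla ?_ ?_ hk
    · intro q hqj hq
      refine MonteCarloTesting.stepUpRejects_of_forall_le hj fun i => ?_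
      by_cases hi : i = j
      · rw [hi, hqj]
      · exact (hq i hi).2.le
    · intro p hpj hp
      refine MonteCarloTesting.not_stepUpRejects hj hpj fun i k hk => ?_
      by_cases hi : i = j
      · rw [hi]
        exact (hlk k hk).trans_lt (hla.trans hpj)
      · exact (hlk k hk).trans_lt (hp i hi).1
  · intro h𝒜 k hk _
    set j : Fin m := ⟨0, hm⟩
    have hj : ∀ l : Fin m, j ≤ l := fun l => Nat.zero_le _
    obtain ⟨u, hau, hu1, huk⟩ := MonteCarloTesting.exists_between_of_forall_gt α j (hα01 j).2
      fun k hk => hα (lt_of_le_of_ne (hj k) (Ne.symm hk))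
    -- The other p-values range over `(α j, u)`.
    refine h𝒜.expectedRuntime_eq_top hε.2 hμ j (hα01 j) (hα01 j).1 hu1 hau ?_ ?_ hk
    · intro q hqj hq
      refine MonteCarloTesting.stepDownRejects_of_le hj hqj.le fun i k hk => ?_
      by_cases hi : i = j
      · rw [hi, hqj]
        exact hau.le.trans (huk k hk)
      · exact (hq i hi).2.le.trans (huk k hk)
    · intro p hpj hp
      refine MonteCarloTesting.not_stepDownRejects_of_forall_lt hj fun i => ?_
      by_cases hi : i = j
      · rw [hi]
        exact hpj
      · exact (hp i hi).1
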